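/- Let $\mathbb{M}_Z^n$ denote $\mathbb{R}^n$ with the norm whose closed unit ball is $\operatorname{conv}([0,1]^n\cup[-1,0]^n)$. A Steiner tree of a finite set $N\subset\mathbb{M}_Z^n$ is a finite tree whose vertices are points of $\mathbb{M}_Z^n$ and whose vertex set contains $N$; its length is the sum of $\|x-y\|$ over all its edges $xy$; a Steiner minimal tree (SMT) of $N$ is a Steiner tree of $N$ of minimum length. The points of $N$ are called the given points. Let $d(\mathbb{M}_Z^n)$ be the maximum degree of a given point in an SMT, taken over all finite sets $N\subset\mathbb{M}_Z^n$, all SMTs of $N$ and all points of $N$. Theorem. For every $n\ge 3$ this maximum exists and $$d(\mathbb{M}_Z^n)=\binom{n+2}{\lfloor (n+2)/2\rfloor}.$$ In particular $d(\mathbb{M}_Z^n)<2^{n+1}-2$ for every $n\ge 3$ (Cieslik conjectured equality). -/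

import Mathlib

/-! ### Steiner minimal trees in a normed space -/

section Steiner

variable {E : Type*} [NormedAddCommGroup E]

/-- The length `‖x - y‖` of the edge `xy`. -/
noncomputable def edgeLength : Sym2 E → ℝ :=
  Sym2.lift ⟨fun x y => ‖x - y‖, fun x y => norm_sub_rev x y⟩

/-- The length of a graph whose vertices are points of `E`: the sum of the lengths of its edges
(used for graphs with finitely many vertices only). -/
noncomputable def graphLength (T : (⊤ : SimpleGraph E).Subgraph) : ℝ :=
  ∑ᶠ e ∈ T.edgeSet, edgeLength e

/-- A Steiner tree of `N`: a finite tree whose vertices are points of `E`, the points of `N`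
being among them. -/
def IsSteinerTree (N : Finset E) (T : (⊤ : SimpleGraph E).Subgraph) : Prop :=
  T.verts.Finite ∧ (N : Set E) ⊆ T.verts ∧ T.coe.IsTree

/-- A Steiner minimal tree of `N`: a shortest Steiner tree of `N`. -/
def IsSteinerMinimalTree (N : Finset E) (T : (⊤ : SimpleGraph E).Subgraph) : Prop :=
  IsSteinerTree N T ∧ ∀ T' : (⊤ : SimpleGraph E).Subgraph,
    IsSteinerTree N T' → graphLength T ≤ graphLength T'

variable (E) in
/-- The set of all degrees of given points `p ∈ N` in Steiner minimal trees of finite sets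
`N` of points of `E`. -/
def givenPointDegrees : Set ℕ :=
  {k | ∃ (N : Finset E) (T : (⊤ : SimpleGraph E).Subgraph) (p : E),
    IsSteinerMinimalTree N T ∧ p ∈ N ∧ (T.neighborSet p).ncard = k}

end Steiner

/-! ### The space `M_Z^n` -/

/-- The convex body `conv([0,1]^n ∪ [-1,0]^n)` in `ℝ^n`. -/
def zBody (n : ℕ) : Set (Fin n → ℝ) :=
  convexHull ℝ (Set.Icc 0 1 ∪ Set.Icc (-1) 0)

theorem zBody_convex (n : ℕ) : Convex ℝ (zBody n) := convex_convexHull ℝ _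

theorem zBody_neg (n : ℕ) : ∀ x ∈ zBody n, -x ∈ zBody n := by
  intro x hx
  have h : -(zBody n) = zBody n := by
    rw [zBody, ← convexHull_neg, Set.union_neg]
    simp [Set.union_comm]
  rw [← h]
  simpa using hx

theorem zBody_mem_nhds (n : ℕ) : zBody n ∈ nhds (0 : Fin n → ℝ) := by
  refine Filter.mem_of_superset (Metric.closedBall_mem_nhds 0 (by norm_num : (0 : ℝ) < 1 / 2)) ?_
  intro x hx
  rw [mem_closedBall_zero_iff, pi_norm_le_iff_of_nonneg (by norm_num)] at hx
  have h1 : (2 : ℝ) • (x ⊔ 0) ∈ zBody n := by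
    refine subset_convexHull ℝ _ (Or.inl ⟨fun i => ?_, fun i => ?_⟩)
    · simp
    · have := abs_le.1 (hx i)
      have h : max (x i) 0 ≤ 1 / 2 := max_le this.2 (by norm_num)
      simp only [Pi.smul_apply, Pi.sup_apply, Pi.zero_apply, smul_eq_mul, Pi.one_apply]
      linarith
  have h2 : (2 : ℝ) • (x ⊓ 0) ∈ zBody n := by
    refine subset_convexHull ℝ _ (Or.inr ⟨fun i => ?_, fun i => ?_⟩)
    · have := abs_le.1 (hx i)
      have h : -(1 / 2) ≤ min (x i) 0 := le_min this.1 (by norm_num)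
      simp only [Pi.smul_apply, Pi.inf_apply, Pi.zero_apply, smul_eq_mul, Pi.neg_apply,
        Pi.one_apply]
      linarith
    · have h : min (x i) 0 ≤ 0 := min_le_right _ _
      simp only [Pi.smul_apply, Pi.inf_apply, Pi.zero_apply, smul_eq_mul]
      linarith
  have h3 := zBody_convex n h1 h2 (by norm_num : (0 : ℝ) ≤ 1 / 2)
    (by norm_num : (0 : ℝ) ≤ 1 / 2) (by norm_num)
  convert h3 using 1
  ext i
  have h := max_add_min (x i) 0
  simp only [Pi.add_apply, Pi.smul_apply, Pi.sup_apply, Pi.inf_apply, Pi.zero_apply, smul_eq_mul]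
  linarith

theorem zBody_absorbent (n : ℕ) : Absorbent ℝ (zBody n) := absorbent_nhds_zero (zBody_mem_nhds n)

theorem zBody_isCompact (n : ℕ) : IsCompact (zBody n) := by
  have h : zBody n = (fun p : ℝ × (Fin n → ℝ) × (Fin n → ℝ) => p.2.1 + p.1 • (p.2.2 - p.2.1)) ''
      (Set.Icc 0 1 ×ˢ Set.Icc 0 1 ×ˢ Set.Icc (-1) 0) := by
    rw [zBody, convexHull_union (Set.nonempty_Icc.2 zero_le_one)
      (Set.nonempty_Icc.2 (neg_nonpos.2 zero_le_one)),
      (convex_Icc _ _).convexHull_eq, (convex_Icc _ _).convexHull_eq]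
    ext x
    simp only [mem_convexJoin, segment_eq_image', Set.mem_image, Set.mem_prod, Prod.exists]
    constructor
    · rintro ⟨a, ha, b, hb, t, ht, rfl⟩
      exact ⟨t, a, b, ⟨ht, ha, hb⟩, rfl⟩
    · rintro ⟨t, a, b, ⟨ht, ha, hb⟩, rfl⟩
      exact ⟨a, ha, b, hb, t, ht, rfl⟩
  rw [h]
  exact (isCompact_Icc.prod (isCompact_Icc.prod isCompact_Icc)).image (by fun_prop)

/-- The real vector space `ℝ^n`, to be normed with unit ball `zBody n`. -/
def MZ (n : ℕ) : Type := Fin n → ℝ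

instance (n : ℕ) : AddCommGroup (MZ n) := inferInstanceAs (AddCommGroup (Fin n → ℝ))

instance (n : ℕ) : Module ℝ (MZ n) := inferInstanceAs (Module ℝ (Fin n → ℝ))

/-- The norm of `M_Z^n` is the gauge of `zBody n`, i.e. the norm with unit ball `zBody n`. -/
noncomputable instance (n : ℕ) : NormedAddCommGroup (MZ n) :=
  AddGroupNorm.toNormedAddCommGroup
    { toFun := fun x => gauge (zBody n) x
      map_zero' := gauge_zero
      add_le' := fun x y => gauge_add_le (zBody_convex n) (zBody_absorbent n) x y
      neg' := fun x => gauge_neg (zBody_neg n) x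
      eq_zero_of_map_eq_zero' := fun _ hx =>
        (gauge_eq_zero (zBody_absorbent n)
          (NormedSpace.isVonNBounded_of_isBounded ℝ (zBody_isCompact n).isBounded)).1 hx }

theorem MZ.norm_def {n : ℕ} (x : MZ n) : ‖x‖ = gauge (zBody n) x := rfl

noncomputable instance (n : ℕ) : NormedSpace ℝ (MZ n) where
  norm_smul_le a x := by
    have h : gauge (zBody n) (a • (show Fin n → ℝ from x)) = |a| * gauge (zBody n) x := by
      rcases le_total 0 a with ha | ha
      · rw [gauge_smul_of_nonneg ha, abs_of_nonneg ha, smul_eq_mul]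
      · rw [← gauge_neg (zBody_neg n), ← neg_smul, gauge_smul_of_nonneg (by linarith),
          abs_of_nonpos ha, smul_eq_mul]
    exact h.le

/-- The closed unit ball of `M_Z^n` is `conv([0,1]^n ∪ [-1,0]^n)`. -/
theorem MZ.closedBall_eq (n : ℕ) : Metric.closedBall (0 : MZ n) 1 = zBody n := by
  ext x
  rw [mem_closedBall_zero_iff, MZ.norm_def]
  refine (gauge_le_one_iff_mem_closure (zBody_convex n) (zBody_mem_nhds n)).trans ?_
  have h : closure (zBody n) = zBody n := (zBody_isCompact n).isClosed.closure_eq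
  exact iff_of_eq (congrArg (fun s : Set (Fin n → ℝ) => (show Fin n → ℝ from x) ∈ s) h)

/-! Prepend a coordinate 0, so that `MZ n` becomes the space of vectors indexed by an (n+1)-element
set modulo constants. The norm is then the oscillation, the largest minus the smallest coordinate
(`MZ.coord_sub_coord_le_norm`, `MZ.norm_le_of_coord_sub_le`).

Upper bound. Send a neighbour q of p to the set A of maximal coordinates of q - p. A short step
along the indicator of A brings q nearer by the full length of the step. Two neighbours with the
same A could share such a step, and three neighbours whose sets form a chain could share two Steiner
points; both exchanges shorten the tree (`MZ.argmax_injOn_neighborSet`,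
`MZ.not_argmax_three_chain`). So the degree is at most the size of a family without a three-chain on
n+1 points, which Sperner's theorem on n+2 points bounds by the middle binomial coefficient.

Lower bound. The indicators of the sets in two consecutive middle layers are unit vectors, and there
are exactly that many. The star joining them to 0 is minimal: any competing tree is rooted at 0, and
a lower bound for the length of each branch, in terms of coordinate differences at its root, is
propagated from the leaves (`MZ.BranchBound`, `MZ.BranchBound.merge`, `accumulate_at_root`). At 0
all differences vanish, which leaves the number of terminals (`MZ.card_le_graphLength`). -/

/-! ### Set families -/

section SetFamily

variable {α : Type*} [DecidableEq α]

/-- A family of sets without a chain of three members is at most as large as the largest binomial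
coefficient of `card α + 1`. -/
theorem card_le_choose_of_no_three_chain [Fintype α] (F : Finset (Finset α))
    (hF : ∀ A ∈ F, ∀ B ∈ F, ∀ C ∈ F, A ⊂ B → ¬ B ⊂ C) :
    F.card ≤ (Fintype.card α + 1).choose ((Fintype.card α + 1) / 2) := by
  classical
  -- Adding a new point to exactly the minimal members of `F` destroys the inclusions between its
  -- two levels, so the image is an antichain on one more point.
  let f : Finset α → Finset (Option α) := fun A =>
    if ∃ B ∈ F, B ⊂ A then A.map Function.Embedding.some else A.insertNone
  have hnone : ∀ A, none ∈ f A ↔ ¬ ∃ B ∈ F, B ⊂ A := by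
    intro A
    by_cases h : ∃ B ∈ F, B ⊂ A <;> simp [f, h]
  have hsome : ∀ A a, some a ∈ f A ↔ a ∈ A := by
    intro A a
    by_cases h : ∃ B ∈ F, B ⊂ A <;> simp [f, h]
  have hsub : ∀ A B, f A ⊆ f B → A ⊆ B := fun A B h a ha =>
    (hsome B a).1 (h ((hsome A a).2 ha))
  have hinj : Function.Injective f := fun A B h =>
    (hsub A B h.subset).antisymm (hsub B A h.symm.subset)
  have hanti : IsAntichain (· ⊆ ·) (SetLike.coe (F.image f)) := by
    intro X hX Y hY hne hXY
    simp only [SetLike.mem_coe, Finset.mem_image] at hX hY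
    obtain ⟨A, hA, rfl⟩ := hX
    obtain ⟨B, hB, rfl⟩ := hY
    have hAB : A ⊂ B := (hsub A B hXY).ssubset_of_ne fun h => hne (by rw [h])
    by_cases h : ∃ C ∈ F, C ⊂ A
    · obtain ⟨C, hC, hCA⟩ := h
      exact hF C hC A hA B hB hCA hAB
    · exact (hnone B).1 (hXY ((hnone A).2 h)) ⟨A, hA, hAB⟩
  have h := hanti.sperner
  rwa [Finset.card_image_of_injective _ hinj, Fintype.card_option] at h

/-- The family of the `k`-element and `(k + 1)`-element sets. -/
def twoLayers (α : Type*) [Fintype α] [DecidableEq α] (k : ℕ) : Finset (Finset α) :=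
  Finset.powersetCard k Finset.univ ∪ Finset.powersetCard (k + 1) Finset.univ

theorem mem_twoLayers [Fintype α] {k : ℕ} {S : Finset α} :
    S ∈ twoLayers α k ↔ S.card = k ∨ S.card = k + 1 := by
  simp [twoLayers]

theorem card_twoLayers [Fintype α] (k : ℕ) :
    (twoLayers α k).card = (Fintype.card α + 1).choose (k + 1) := by
  rw [twoLayers, Finset.card_union_of_disjoint, Finset.card_powersetCard,
    Finset.card_powersetCard, Finset.card_univ, Nat.choose_succ_succ]
  rw [Finset.disjoint_left]
  intro S h1 h2
  simp only [Finset.mem_powersetCard] at h1 h2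
  omega

/-- If both crossed inclusions held, they would be strict, so `S`, `S'` would lie in the lower layer
and `T`, `T'` in the upper one. Then `S ∪ S'` has at least k+1 elements and lies in both `T` and
`T'`, forcing `T = T'`. This is the only place where the choice of two consecutive layers enters the
minimality of the star. -/
theorem not_subset_of_mem_twoLayers [Fintype α] {k : ℕ} {S T S' T' : Finset α}
    (hS : S ∈ twoLayers α k) (hT : T ∈ twoLayers α k) (hS' : S' ∈ twoLayers α k)
    (hT' : T' ∈ twoLayers α k) (hST : S ⊆ T) (hST' : S' ⊆ T') (hSS : S ≠ S') (hSS' : S ≠ T')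
    (hTS : T ≠ S') (hTT : T ≠ T') (h : S ⊆ T') : ¬ S' ⊆ T := by
  intro h'
  rw [mem_twoLayers] at hS hT hS' hT'
  have h1 := Finset.card_lt_card (h.ssubset_of_ne hSS')
  have h2 := Finset.card_lt_card (h'.ssubset_of_ne (Ne.symm hTS))
  have h3 : S ⊂ S ∪ S' := by
    refine Finset.subset_union_left.ssubset_of_ne fun h4 => ?_
    have h5 : S' ⊆ S := by rw [h4]; exact Finset.subset_union_right
    exact hSS (Finset.eq_of_subset_of_card_le h5 (by omega)).symm
  have h4 := Finset.card_lt_card h3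
  have h5 := Finset.eq_of_subset_of_card_le (Finset.union_subset hST h') (by omega)
  have h6 := Finset.eq_of_subset_of_card_le (Finset.union_subset h hST') (by omega)
  exact hTT (h5.symm.trans h6)

theorem choose_half_lt_two_pow {n : ℕ} (hn : 3 ≤ n) :
    (n + 2).choose ((n + 2) / 2) < 2 ^ (n + 1) - 2 := by
  induction n, hn using Nat.le_induction with
  | base => decide
  | succ n hn ih =>
    have h : (n + 1 + 2).choose ((n + 1 + 2) / 2) ≤ 2 * (n + 2).choose ((n + 2) / 2) := by
      obtain ⟨k, hk⟩ : ∃ k, (n + 1 + 2) / 2 = k + 1 := ⟨(n + 1) / 2, by omega⟩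
      rw [hk, show n + 1 + 2 = (n + 2) + 1 by ring, Nat.choose_succ_succ']
      have h1 := Nat.choose_le_middle k (n + 2)
      have h2 := Nat.choose_le_middle (k + 1) (n + 2)
      omega
    rw [pow_succ]
    omega

end SetFamily

/-! ### Homogeneous coordinates on `M_Z^n` -/

namespace MZ

variable {n : ℕ}

/-- The coordinates of `x`, preceded by an additional coordinate `0`. -/
def coord (x : MZ n) (a : Option (Fin n)) : ℝ := a.elim 0 (show Fin n → ℝ from x)

@[simp] theorem coord_none (x : MZ n) : coord x none = 0 := rfl

@[simp] theorem coord_zero (a : Option (Fin n)) : coord (0 : MZ n) a = 0 := by cases a <;> rfl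

@[simp] theorem coord_sub (x y : MZ n) (a : Option (Fin n)) :
    coord (x - y) a = coord x a - coord y a := by
  cases a
  · simp
  · rfl

@[simp] theorem coord_smul (c : ℝ) (x : MZ n) (a : Option (Fin n)) :
    coord (c • x) a = c * coord x a := by
  cases a
  · simp
  · rfl

theorem ext_coord {x y : MZ n} (h : ∀ a, coord x a = coord y a) : x = y :=
  funext fun i => h (some i)

/-- The point whose coordinates are `w` up to an additive constant. -/
def ofCoord (w : Option (Fin n) → ℝ) : MZ n := show Fin n → ℝ from fun i => w (some i) - w none

@[simp] theorem coord_ofCoord (w : Option (Fin n) → ℝ) (a : Option (Fin n)) :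
    coord (ofCoord w) a = w a - w none := by
  cases a
  · simp
  · rfl

theorem mem_zBody_iff {x : MZ n} : (show Fin n → ℝ from x) ∈ zBody n ↔ ‖x‖ ≤ 1 := by
  rw [← mem_closedBall_zero_iff]
  exact (Set.ext_iff.1 (closedBall_eq n) x).symm

/-- A coordinate difference is linear and at most 1 on both generating cubes, hence on their convex
hull; the general case follows by scaling. -/
theorem coord_sub_coord_le_norm (x : MZ n) (a b : Option (Fin n)) :
    coord x a - coord x b ≤ ‖x‖ := by
  have key : ∀ y : MZ n, ‖y‖ ≤ 1 → coord y a - coord y b ≤ 1 := by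
    intro y hy
    have hconv : Convex ℝ {z : Fin n → ℝ | coord (n := n) z a - coord (n := n) z b ≤ 1} := by
      intro z hz w hw s t hs ht hst
      simp only [Set.mem_ofPred_eq] at hz hw ⊢
      have h1 : ∀ c, coord (n := n) (s • z + t • w) c
          = s * coord (n := n) z c + t * coord (n := n) w c := by
        intro c
        cases c
        · simp [coord]
        · rfl
      rw [h1, h1]
      nlinarith
    refine convexHull_min ?_ hconv (mem_zBody_iff.2 hy)
    rintro z (⟨h0, h1⟩ | ⟨h0, h1⟩)
    · have hz : ∀ c, 0 ≤ coord (n := n) z c ∧ coord (n := n) z c ≤ 1 := by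
        rintro (_ | i)
        · simp [coord]
        · exact ⟨h0 i, h1 i⟩
      have := hz a
      have := hz b
      simp only [Set.mem_ofPred_eq]
      linarith
    · have hz : ∀ c, -1 ≤ coord (n := n) z c ∧ coord (n := n) z c ≤ 0 := by
        rintro (_ | i)
        · simp [coord]
        · exact ⟨h0 i, h1 i⟩
      have := hz a
      have := hz b
      simp only [Set.mem_ofPred_eq]
      linarith
  rcases eq_or_ne x 0 with rfl | hx
  · simp
  · have hpos := norm_pos_iff.2 hx
    have h := key (‖x‖⁻¹ • x) (by rw [norm_smul, norm_inv, norm_norm, inv_mul_cancel₀ hpos.ne'])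
    rw [coord_smul, coord_smul, ← mul_sub, inv_mul_le_iff₀ hpos, mul_one] at h
    exact h

theorem norm_le_of_Icc {c : ℝ} (hc : 0 ≤ c) {x : MZ n}
    (h : (∀ a, 0 ≤ coord x a ∧ coord x a ≤ c)) : ‖x‖ ≤ c := by
  rcases hc.eq_or_lt with rfl | hc
  · have : x = 0 := ext_coord fun a => by
      rw [coord_zero]
      exact le_antisymm (h a).2 (h a).1
    simp [this]
  · have h1 : ‖c⁻¹ • x‖ ≤ 1 := by
      refine mem_zBody_iff.1 (subset_convexHull ℝ _ (Or.inl ⟨fun i => ?_, fun i => ?_⟩))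
      · exact mul_nonneg (inv_nonneg.2 hc.le) (h (some i)).1
      · exact (inv_mul_le_iff₀ hc).2 ((h (some i)).2.trans_eq (mul_one c).symm)
    rwa [norm_smul, norm_inv, Real.norm_of_nonneg hc.le, inv_mul_le_iff₀ hc, mul_one] at h1

theorem norm_le_of_coord_sub_le {c : ℝ} {x : MZ n} (h : ∀ a b, coord x a - coord x b ≤ c) :
    ‖x‖ ≤ c := by
  obtain ⟨a, -, ha⟩ := Finset.exists_max_image Finset.univ (coord x) Finset.univ_nonempty
  obtain ⟨b, -, hb⟩ := Finset.exists_min_image Finset.univ (coord x) Finset.univ_nonempty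
  have ha0 : 0 ≤ coord x a := ha none (Finset.mem_univ _)
  have hb0 : coord x b ≤ 0 := hb none (Finset.mem_univ _)
  -- The positive and negative parts are multiples of points of the cube, with norms at most the
  -- maximum and minus the minimum of the coordinates.
  let p : MZ n := ofCoord fun c => max (coord x c) 0
  let q : MZ n := ofCoord fun c => max (-coord x c) 0
  have hx : x = p - q := ext_coord fun c => by
    simp only [p, q, coord_sub, coord_ofCoord, coord_none, neg_zero, max_self, sub_zero]
    rcases le_total (coord x c) 0 with h | h
    · rw [max_eq_right h, max_eq_left (by linarith)]; ring
    · rw [max_eq_left h, max_eq_right (by linarith)]; ring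
  have hp : ‖p‖ ≤ coord x a := norm_le_of_Icc ha0 fun c => by
    simpa [p, ha0] using ha c (Finset.mem_univ _)
  have hq : ‖q‖ ≤ -coord x b := norm_le_of_Icc (by linarith) fun c => by
    simpa [q, hb0] using hb c (Finset.mem_univ _)
  calc ‖x‖ = ‖p - q‖ := by rw [← hx]
    _ ≤ ‖p‖ + ‖q‖ := norm_sub_le _ _
    _ ≤ c := by linarith [h a b]

/-- The set of the largest coordinates of `x`. -/
noncomputable def argmax (x : MZ n) : Finset (Option (Fin n)) :=
  open Classical in Finset.univ.filter fun a => ∀ b, coord x b ≤ coord x a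

theorem mem_argmax {x : MZ n} {a : Option (Fin n)} :
    a ∈ argmax x ↔ ∀ b, coord x b ≤ coord x a := by
  simp [argmax]

/-- Only differences starting at a maximal coordinate and ending at a non-maximal one need `w` to
jump by 1. All others are already smaller than the norm by a fixed gap, which absorbs a small step.
The range up to 2 admits sums of two indicators. -/
theorem exists_norm_sub_le {y : MZ n} (hy : y ≠ 0) : ∃ δ : ℝ, 0 < δ ∧
    ∀ ε : ℝ, 0 < ε → ε ≤ δ → ∀ w : Option (Fin n) → ℝ, (∀ a, 0 ≤ w a ∧ w a ≤ 2) →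
      (∀ a ∈ argmax y, ∀ b ∉ argmax y, w b + 1 ≤ w a) →
      ‖y - ε • ofCoord w‖ ≤ ‖y‖ - ε := by
  obtain ⟨m, -, hm⟩ := Finset.exists_max_image Finset.univ (coord y) Finset.univ_nonempty
  have hm' : m ∈ argmax y := mem_argmax.2 fun b => hm b (Finset.mem_univ _)
  have hgap : ∀ c : Option (Fin n), ∃ g : ℝ, 0 < g ∧ (c ∉ argmax y → coord y c + g ≤ coord y m) := by
    intro c
    by_cases hc : c ∈ argmax y
    · exact ⟨1, one_pos, fun h => absurd hc h⟩
    · refine ⟨coord y m - coord y c, sub_pos.2 (lt_of_le_of_ne (hm c (Finset.mem_univ _)) ?_),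
        fun _ => by linarith⟩
      exact fun h => hc (mem_argmax.2 fun b => h ▸ hm b (Finset.mem_univ _))
  choose g hg0 hg using hgap
  obtain ⟨c₀, -, hc₀⟩ := Finset.exists_min_image Finset.univ g Finset.univ_nonempty
  have hnorm := norm_pos_iff.2 hy
  -- The gap must cover `3 * ε`: up to `2 * ε` from the variation of `w`, and the desired gain `ε`.
  refine ⟨min (g c₀ / 3) (‖y‖ / 3), by have := hg0 c₀; positivity, fun ε hε hδ w hw hA => ?_⟩
  have hε1 : 3 * ε ≤ g c₀ := by linarith [hδ.trans (min_le_left _ _)]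
  have hε2 : 3 * ε ≤ ‖y‖ := by linarith [hδ.trans (min_le_right _ _)]
  refine norm_le_of_coord_sub_le fun a b => ?_
  simp only [coord_sub, coord_smul, coord_ofCoord]
  have hab := coord_sub_coord_le_norm y a b
  have hmb := coord_sub_coord_le_norm y m b
  by_cases ha : a ∈ argmax y
  · by_cases hb : b ∈ argmax y
    · have h1 := mem_argmax.1 hb a
      nlinarith [hw a, hw b]
    · nlinarith [hA a ha b hb]
  · have h1 := hg a ha
    have h2 := hc₀ a (Finset.mem_univ _)
    nlinarith [hw a, hw b]

end MZ

/-! ### Steiner trees in a normed group -/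

section Steiner

variable {E : Type*} [NormedAddCommGroup E]

@[simp] theorem edgeLength_mk (x y : E) : edgeLength s(x, y) = ‖x - y‖ := rfl

theorem edgeLength_nonneg (e : Sym2 E) : 0 ≤ edgeLength e := by
  induction e with
  | _ x y => exact norm_nonneg (x - y)

/-! ### Exchanging edges in a Steiner minimal tree -/

theorem SimpleGraph.Subgraph.edgeSet_finite_of_verts_finite {V : Type*} {G : SimpleGraph V}
    {T : G.Subgraph} (h : T.verts.Finite) : T.edgeSet.Finite := by
  refine ((h.prod h).image fun p : V × V => s(p.1, p.2)).subset fun e he => ?_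
  induction e with
  | _ x y => exact ⟨(x, y), ⟨T.edge_vert he, T.edge_vert (T.adj_symm he)⟩, rfl⟩

theorem graphLength_eq_sum {T : (⊤ : SimpleGraph E).Subgraph} (h : T.edgeSet.Finite) :
    graphLength T = ∑ e ∈ h.toFinset, edgeLength e :=
  finsum_mem_eq_finite_toFinset_sum _ h

/-- A spanning tree of the component of `p` suffices. Hence competitors can be given as mere edge
sets, with cycles, loops or superfluous components allowed. -/
theorem exists_isSteinerTree_of_reachable [DecidableEq E] {N : Finset E} {p : E}
    (D : Finset (Sym2 E))
    (hD : ∀ q ∈ N, (SimpleGraph.fromEdgeSet (D : Set (Sym2 E))).Reachable p q) :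
    ∃ T : (⊤ : SimpleGraph E).Subgraph, IsSteinerTree N T ∧ graphLength T ≤ ∑ e ∈ D, edgeLength e := by
  set G := SimpleGraph.fromEdgeSet (D : Set (Sym2 E)) with hG
  let C := G.connectedComponentMk p
  obtain ⟨t, htC, ht⟩ := C.connected_toSimpleGraph.exists_isTree_le
  have htG : ∀ x y : C, t.Adj x y → G.Adj x y := fun x y h => htC h
  let T : (⊤ : SimpleGraph E).Subgraph :=
    { verts := C.supp
      Adj := fun x y => ∃ (hx : x ∈ C.supp) (hy : y ∈ C.supp), t.Adj ⟨x, hx⟩ ⟨y, hy⟩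
      adj_sub := fun ⟨hx, hy, h⟩ => (htG _ _ h).ne
      edge_vert := fun ⟨hx, _, _⟩ => hx
      symm := ⟨fun x y ⟨hx, hy, h⟩ => ⟨hy, hx, h.symm⟩⟩ }
  have hTcoe : T.coe = t := by
    ext x y
    exact ⟨fun ⟨_, _, h⟩ => h, fun h => ⟨x.2, y.2, h⟩⟩
  have hedge : T.edgeSet ⊆ (D : Set (Sym2 E)) := by
    intro e he
    induction e with
    | _ x y =>
      obtain ⟨hx, hy, h⟩ := he
      exact ((SimpleGraph.fromEdgeSet_adj _).1 (htG _ _ h)).1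
  have hfin : C.supp.Finite := by
    refine ((Set.finite_singleton p).union (D.biUnion fun e => e.toFinset).finite_toSet).subset ?_
    intro x hx
    by_cases hxp : x = p
    · exact Or.inl hxp
    · have hr : G.Reachable x p := SimpleGraph.ConnectedComponent.exact hx
      obtain ⟨w⟩ := hr
      cases w with
      | nil => exact absurd rfl hxp
      | cons h _ =>
        refine Or.inr ?_
        simp only [Finset.coe_biUnion, Set.mem_iUnion]
        exact ⟨_, ((SimpleGraph.fromEdgeSet_adj _).1 h).1, by simp⟩
  refine ⟨T, ⟨hfin, fun q hq => ?_, ?_⟩, ?_⟩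
  · exact SimpleGraph.ConnectedComponent.sound (hD q hq).symm
  · rw [hTcoe]; exact ht
  · have h := SimpleGraph.Subgraph.edgeSet_finite_of_verts_finite (T := T) hfin
    rw [graphLength_eq_sum h]
    exact Finset.sum_le_sum_of_subset_of_nonneg (fun e he => hedge (h.mem_toFinset.1 he))
      fun e _ _ => edgeLength_nonneg e

theorem SimpleGraph.Subgraph.reachable_spanningCoe {V : Type*} {G : SimpleGraph V}
    {T : G.Subgraph} (hT : T.coe.Connected) {x y : V} (hx : x ∈ T.verts) (hy : y ∈ T.verts) :
    T.spanningCoe.Reachable x y :=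
  (hT.preconnected ⟨x, hx⟩ ⟨y, hy⟩).map
    (⟨Subtype.val, fun h => h⟩ : T.coe →g T.spanningCoe)

/-- Replacing the edges `R` of a Steiner minimal tree by edges `D` which connect the ends of each
edge of `R` does not make the tree shorter. -/
theorem IsSteinerMinimalTree.sum_le_sum {N : Finset E} {T : (⊤ : SimpleGraph E).Subgraph}
    (hT : IsSteinerMinimalTree N T) {p : E} (hp : p ∈ N) {R D : Finset (Sym2 E)}
    (hR : (R : Set (Sym2 E)) ⊆ T.edgeSet)
    (hD : ∀ x y, s(x, y) ∈ R → (SimpleGraph.fromEdgeSet (D : Set (Sym2 E))).Reachable x y) :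
    ∑ e ∈ R, edgeLength e ≤ ∑ e ∈ D, edgeLength e := by
  classical
  obtain ⟨⟨hfin, hN, htree⟩, hmin⟩ := hT
  have hE := SimpleGraph.Subgraph.edgeSet_finite_of_verts_finite hfin
  set D' : Finset (Sym2 E) := (hE.toFinset \ R) ∪ D with hD'
  have hreach : ∀ x y, T.spanningCoe.Reachable x y →
      (SimpleGraph.fromEdgeSet (D' : Set (Sym2 E))).Reachable x y := by
    rintro x y ⟨w⟩
    induction w with
    | nil => exact SimpleGraph.Reachable.refl _
    | @cons u v z h _ ih =>
      refine SimpleGraph.Reachable.trans ?_ ih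
      by_cases hR' : s(u, v) ∈ R
      · refine (hD u v hR').mono (SimpleGraph.fromEdgeSet_mono ?_)
        exact_mod_cast Finset.subset_union_right
      · refine SimpleGraph.Adj.reachable ((SimpleGraph.fromEdgeSet_adj _).2 ⟨?_, h.ne⟩)
        simp only [hD', Finset.mem_coe, Finset.mem_union, Finset.mem_sdiff, Set.Finite.mem_toFinset]
        exact Or.inl ⟨h, hR'⟩
  obtain ⟨T', hT', hlen⟩ := exists_isSteinerTree_of_reachable (N := N) (p := p) D' fun q hq =>
    hreach p q (SimpleGraph.Subgraph.reachable_spanningCoe htree.connected (hN hp) (hN hq))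
  have h1 := (hmin T' hT').trans hlen
  rw [graphLength_eq_sum hE] at h1
  have h2 : ∑ e ∈ D', edgeLength e ≤ ∑ e ∈ hE.toFinset \ R, edgeLength e + ∑ e ∈ D, edgeLength e := by
    rw [← Finset.sum_union_inter]
    exact le_add_of_nonneg_right (Finset.sum_nonneg fun e _ => edgeLength_nonneg e)
  have h3 := Finset.sum_sdiff (f := edgeLength)
    (show R ⊆ hE.toFinset from fun e he => hE.mem_toFinset.2 (hR he))
  linarith

theorem sum_edgeLength_insert_le [DecidableEq E] (e : Sym2 E) (D : Finset (Sym2 E)) :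
    ∑ x ∈ insert e D, edgeLength x ≤ edgeLength e + ∑ x ∈ D, edgeLength x := by
  by_cases h : e ∈ D
  · rw [Finset.insert_eq_of_mem h]
    exact le_add_of_nonneg_left (edgeLength_nonneg e)
  · exact (Finset.sum_insert h).le

theorem reachable_fromEdgeSet_of_mem {V : Type*} {D : Finset (Sym2 V)} {x y : V}
    (h : s(x, y) ∈ D) : (SimpleGraph.fromEdgeSet (D : Set (Sym2 V))).Reachable x y := by
  rcases eq_or_ne x y with rfl | hxy
  · exact SimpleGraph.Reachable.refl _
  · exact SimpleGraph.Adj.reachable ((SimpleGraph.fromEdgeSet_adj _).2 ⟨h, hxy⟩)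

/-! ### Rooted trees -/

/-- A property of a vertex, a length and a set of terminals which is stable under the joining of a
branch by an edge holds at the root of a rooted tree if it holds at each single vertex. -/
theorem accumulate_at_root {σ : Type*} [DecidableEq E] [DecidableEq σ]
    {Q : E → ℝ → Finset σ → Prop}
    (merge : ∀ u v l l' I J, Disjoint I J → Q v l I → Q u l' J → Q v (l + (l' + ‖u - v‖)) (I ∪ J))
    {r : E} (par : E → E) (rank : E → ℕ) (V : Finset E) (hr : r ∈ V)
    (hpar : ∀ v ∈ V, v ≠ r → par v ∈ V ∧ rank (par v) < rank v)
    (l : E → ℝ) (I : E → Finset σ)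
    (hI : ∀ u ∈ V, ∀ v ∈ V, u ≠ v → Disjoint (I u) (I v)) (hQ : ∀ v ∈ V, Q v (l v) (I v)) :
    Q r (∑ v ∈ V, l v + ∑ v ∈ V.erase r, ‖v - par v‖) (V.biUnion I) := by
  induction hc : V.card generalizing V l I with
  | zero => simp [Finset.card_eq_zero.1 hc] at hr
  | succ c ih =>
    by_cases hV : (V.erase r).Nonempty
    -- A vertex of maximal rank is nobody's parent; it is removed and its data are merged into those
    -- of its parent.
    · obtain ⟨u, hu, hmax⟩ := Finset.exists_max_image (V.erase r) rank hV
      obtain ⟨hur, huV⟩ := Finset.mem_erase.1 hu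
      obtain ⟨hpV, hprank⟩ := hpar u huV hur
      have hpu : par u ≠ u := fun h => by rw [h] at hprank; exact lt_irrefl _ hprank
      have hpV' : par u ∈ V.erase u := Finset.mem_erase.2 ⟨hpu, hpV⟩
      have hru : r ∈ V.erase u := Finset.mem_erase.2 ⟨hur.symm, hr⟩
      have key := ih (V.erase u) hru
        (fun v hv hvr => by
          have hvV := Finset.mem_of_mem_erase hv
          refine ⟨Finset.mem_erase.2 ⟨fun h => ?_, (hpar v hvV hvr).1⟩, (hpar v hvV hvr).2⟩
          have h1 := (hpar v hvV hvr).2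
          have h2 := hmax v (Finset.mem_erase.2 ⟨hvr, hvV⟩)
          rw [h] at h1
          omega)
        (Function.update l (par u) (l (par u) + (l u + ‖u - par u‖)))
        (Function.update I (par u) (I (par u) ∪ I u))
        (fun v hv w hw hvw => by
          obtain ⟨hvu, hvV⟩ := Finset.mem_erase.1 hv
          obtain ⟨hwu, hwV⟩ := Finset.mem_erase.1 hw
          by_cases h1 : v = par u
          · subst h1
            rw [Function.update_self, Function.update_of_ne hvw.symm, Finset.disjoint_union_left]
            exact ⟨hI _ hvV w hwV hvw, hI u huV w hwV hwu.symm⟩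
          · rw [Function.update_of_ne h1]
            by_cases h2 : w = par u
            · subst h2
              rw [Function.update_self, Finset.disjoint_union_right]
              exact ⟨hI v hvV _ hwV hvw, hI v hvV u huV hvu⟩
            · rw [Function.update_of_ne h2]
              exact hI v hvV w hwV hvw)
        (fun v hv => by
          obtain ⟨hvu, hvV⟩ := Finset.mem_erase.1 hv
          by_cases h1 : v = par u
          · subst h1
            rw [Function.update_self, Function.update_self]
            exact merge u _ _ _ _ _ (hI _ hvV u huV hvu) (hQ _ hvV) (hQ u huV)
          · rw [Function.update_of_ne h1, Function.update_of_ne h1]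
            exact hQ v hvV)
        (by rw [Finset.card_erase_of_mem huV, hc]; rfl)
      convert key using 1
      · have h1 := Finset.add_sum_erase V l huV
        have h2 := Finset.add_sum_erase _ l hpV'
        have h3 := Finset.add_sum_erase (V.erase r) (fun v => ‖v - par v‖) hu
        rw [Finset.sum_update_of_mem hpV', Finset.sdiff_singleton_eq_erase,
          Finset.erase_right_comm (a := u) (b := r), ← h1, ← h2, ← h3]
        ring
      · ext s
        simp only [Finset.mem_biUnion]
        constructor
        · rintro ⟨v, hv, hs⟩
          by_cases h1 : v = u
          · subst h1
            exact ⟨par v, hpV', by simp [hs]⟩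
          · refine ⟨v, Finset.mem_erase.2 ⟨h1, hv⟩, ?_⟩
            by_cases h2 : v = par u
            · subst h2
              simp [hs]
            · rwa [Function.update_of_ne h2]
        · rintro ⟨v, hv, hs⟩
          by_cases h2 : v = par u
          · subst h2
            rw [Function.update_self, Finset.mem_union] at hs
            exact hs.elim (fun hs => ⟨_, hpV, hs⟩) fun hs => ⟨u, huV, hs⟩
          · rw [Function.update_of_ne h2] at hs
            exact ⟨v, Finset.mem_of_mem_erase hv, hs⟩
    · have hVr : V = {r} := by
        refine Finset.eq_singleton_iff_unique_mem.2 ⟨hr, fun x hx => ?_⟩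
        by_contra h
        exact hV ⟨x, Finset.mem_erase.2 ⟨h, hx⟩⟩
      subst hVr
      simpa using hQ r hr

/-- The parent is the next vertex on a shortest walk to the root, the rank is the distance to the
root. -/
theorem SimpleGraph.Subgraph.exists_parent {V : Type*} {G : SimpleGraph V} {T : G.Subgraph}
    (hT : T.coe.Connected) {r : V} (hr : r ∈ T.verts) : ∃ (par : V → V) (rank : V → ℕ),
      ∀ v ∈ T.verts, v ≠ r → T.Adj v (par v) ∧ rank (par v) < rank v := by
  have h : ∀ v, ∃ w, v ∈ T.verts → v ≠ r →
      T.Adj v w ∧ T.spanningCoe.dist w r < T.spanningCoe.dist v r := by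
    intro v
    by_cases hv : v ∈ T.verts
    · by_cases hvr : v = r
      · exact ⟨v, fun _ h => absurd hvr h⟩
      · obtain ⟨w, hw⟩ := (SimpleGraph.Subgraph.reachable_spanningCoe hT hv hr).exists_walk_length_eq_dist
        cases w with
        | nil => exact absurd rfl hvr
        | @cons _ u _ h p =>
          refine ⟨u, fun _ _ => ⟨h, ?_⟩⟩
          have h1 := SimpleGraph.dist_le p
          rw [SimpleGraph.Walk.length_cons] at hw
          omega
    · exact ⟨v, fun h => absurd h hv⟩
  choose par hpar using h
  exact ⟨par, fun v => T.spanningCoe.dist v r, hpar⟩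

theorem sum_parent_le_graphLength [DecidableEq E] {T : (⊤ : SimpleGraph E).Subgraph}
    (hT : T.verts.Finite) {r : E} {par : E → E} {rank : E → ℕ}
    (hpar : ∀ v ∈ T.verts, v ≠ r → T.Adj v (par v) ∧ rank (par v) < rank v) :
    ∑ v ∈ hT.toFinset.erase r, ‖v - par v‖ ≤ graphLength T := by
  have hE := SimpleGraph.Subgraph.edgeSet_finite_of_verts_finite hT
  have hpar' : ∀ v ∈ hT.toFinset.erase r, T.Adj v (par v) ∧ rank (par v) < rank v := fun v hv =>
    hpar v (hT.mem_toFinset.1 (Finset.mem_of_mem_erase hv)) (Finset.ne_of_mem_erase hv)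
  rw [graphLength_eq_sum hE]
  -- Two vertices cannot be each other's parents, because the rank decreases strictly.
  have hinj : Set.InjOn (fun v => s(v, par v)) (hT.toFinset.erase r : Finset E) := by
    intro v hv w hw h
    rcases Sym2.eq_iff.1 h with ⟨h1, -⟩ | ⟨h1, h2⟩
    · exact h1
    · have h3 := (hpar' v hv).2
      have h4 := (hpar' w hw).2
      rw [h2] at h3
      rw [← h1] at h4
      omega
  calc ∑ v ∈ hT.toFinset.erase r, ‖v - par v‖
      = ∑ e ∈ (hT.toFinset.erase r).image fun v => s(v, par v), edgeLength e := by
        rw [Finset.sum_image hinj]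
        rfl
    _ ≤ _ := by
        refine Finset.sum_le_sum_of_subset_of_nonneg (fun e he => ?_) fun e _ _ => edgeLength_nonneg e
        obtain ⟨v, hv, rfl⟩ := Finset.mem_image.1 he
        exact hE.mem_toFinset.2 (hpar' v hv).1

/-! ### Stars -/

/-- The star with centre `0` and leaves `P`. -/
def starTree (P : Finset E) (h0 : (0 : E) ∉ P) : (⊤ : SimpleGraph E).Subgraph where
  verts := insert 0 (P : Set E)
  Adj x y := (x = 0 ∧ y ∈ P) ∨ (y = 0 ∧ x ∈ P)
  adj_sub := by
    rintro x y (⟨rfl, hy⟩ | ⟨rfl, hx⟩) rfl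
    · exact h0 hy
    · exact h0 hx
  edge_vert := by
    rintro x y (⟨rfl, hy⟩ | ⟨rfl, hx⟩)
    · exact Or.inl rfl
    · exact Or.inr hx
  symm := ⟨fun x y h => h.symm⟩

theorem starTree_isTree (P : Finset E) (h0 : (0 : E) ∉ P) : (starTree P h0).coe.IsTree := by
  have hc : (starTree P h0).coe.Connected := by
    have h : ∀ x : (starTree P h0).verts,
        (starTree P h0).coe.Reachable x ⟨0, Or.inl rfl⟩ := by
      rintro ⟨x, rfl | hx⟩
      · exact SimpleGraph.Reachable.refl _
      · exact SimpleGraph.Adj.reachable (Or.inr ⟨rfl, hx⟩)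
    have : Nonempty (starTree P h0).verts := ⟨⟨0, Or.inl rfl⟩⟩
    exact ⟨fun x y => (h x).trans (h y).symm⟩
  obtain ⟨t, ht, htree⟩ := hc.exists_isTree_le
  -- A leaf has no neighbour but the centre, so a spanning tree contains every edge of the star and
  -- equals it.
  have hleaf : ∀ x : (starTree P h0).verts, x.1 ∈ P → t.Adj x ⟨0, Or.inl rfl⟩ := by
    intro x hx
    obtain ⟨w⟩ := htree.connected.preconnected x ⟨0, Or.inl rfl⟩
    cases w with
    | nil => exact absurd hx h0
    | @cons _ u _ h _ =>
      have hu : u = ⟨0, Or.inl rfl⟩ := by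
        rcases ht h with ⟨h1, -⟩ | ⟨h1, -⟩
        · rw [h1] at hx
          exact absurd hx h0
        · exact Subtype.ext h1
      rwa [hu] at h
  have heq : (starTree P h0).coe = t := by
    refine le_antisymm (fun x y h => ?_) ht
    rcases h with ⟨h1, h2⟩ | ⟨h1, h2⟩
    · have h3 : x = ⟨0, Or.inl rfl⟩ := Subtype.ext h1
      rw [h3]
      exact (hleaf y h2).symm
    · have h3 : y = ⟨0, Or.inl rfl⟩ := Subtype.ext h1
      rw [h3]
      exact hleaf x h2
  rw [heq]
  exact htree

theorem graphLength_starTree_le (P : Finset E) (h0 : (0 : E) ∉ P) :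
    graphLength (starTree P h0) ≤ ∑ x ∈ P, ‖x‖ := by
  classical
  have hE := SimpleGraph.Subgraph.edgeSet_finite_of_verts_finite (T := starTree P h0)
    (P.finite_toSet.insert 0)
  rw [graphLength_eq_sum hE]
  calc _ ≤ ∑ e ∈ P.image fun x => s(x, 0), edgeLength e := by
        refine Finset.sum_le_sum_of_subset_of_nonneg (fun e he => ?_)
          fun e _ _ => edgeLength_nonneg e
        rw [hE.mem_toFinset] at he
        induction e with
        | _ x y =>
          rcases he with ⟨rfl, hy⟩ | ⟨rfl, hx⟩
          · exact Finset.mem_image.2 ⟨y, hy, Sym2.eq_swap⟩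
          · exact Finset.mem_image.2 ⟨x, hx, rfl⟩
    _ = ∑ x ∈ P, ‖x‖ := by
        rw [Finset.sum_image fun x _ y _ h => Sym2.congr_left.1 h]
        simp

theorem neighborSet_starTree (P : Finset E) (h0 : (0 : E) ∉ P) :
    (starTree P h0).neighborSet 0 = P := by
  ext x
  constructor
  · rintro (⟨-, hx⟩ | ⟨-, hx⟩)
    · exact hx
    · exact absurd hx h0
  · exact fun hx => Or.inl ⟨rfl, hx⟩

end Steiner

/-! ### The star of the middle layers -/

namespace MZ

variable {n : ℕ}

/-- The point whose coordinates are `1` on `S` and `0` elsewhere, up to an additive constant. -/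
noncomputable def indicatorPoint (S : Finset (Option (Fin n))) : MZ n :=
  ofCoord fun a => if a ∈ S then 1 else 0

theorem coord_indicatorPoint_sub (S : Finset (Option (Fin n))) (a b : Option (Fin n)) :
    coord (indicatorPoint S) a - coord (indicatorPoint S) b
      = (if a ∈ S then 1 else 0) - (if b ∈ S then 1 else 0) := by
  simp [indicatorPoint]

theorem norm_indicatorPoint_le (S : Finset (Option (Fin n))) : ‖indicatorPoint S‖ ≤ 1 := by
  refine norm_le_of_coord_sub_le fun a b => ?_
  rw [coord_indicatorPoint_sub]
  split_ifs <;> norm_num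

theorem indicatorPoint_ne_zero {S : Finset (Option (Fin n))} {a b : Option (Fin n)} (ha : a ∈ S)
    (hb : b ∉ S) : indicatorPoint S ≠ 0 := by
  intro h
  have := coord_indicatorPoint_sub S a b
  simp [h, ha, hb] at this

theorem eq_of_indicatorPoint_eq {S T : Finset (Option (Fin n))} {a b : Option (Fin n)} (ha : a ∈ S)
    (hb : b ∉ S) (h : indicatorPoint S = indicatorPoint T) : S = T := by
  have key : ∀ c d, ((if c ∈ S then 1 else 0) - (if d ∈ S then 1 else 0) : ℝ)
      = (if c ∈ T then 1 else 0) - (if d ∈ T then 1 else 0) := fun c d => by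
    rw [← coord_indicatorPoint_sub, h, coord_indicatorPoint_sub]
  have hab := key a b
  have haT : a ∈ T := by
    by_contra haT
    rw [if_pos ha, if_neg hb, if_neg haT] at hab
    split_ifs at hab <;> norm_num at hab
  ext c
  have := key c a
  rw [if_pos ha, if_pos haT] at this
  by_cases h1 : c ∈ S <;> by_cases h2 : c ∈ T <;> simp [h1, h2] at this ⊢

/-- The bound `l` on the length of a tree which contains the point `v` and joins it to the
indicator points of the sets in `I`: either the tree has length at least `card I`, or it falls
short of that by at most a coordinate difference of `v`, for a flexible choice of coordinates. -/
def BranchBound (F : Finset (Finset (Option (Fin n)))) (v : MZ n) (l : ℝ)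
    (I : Finset (Finset (Option (Fin n)))) : Prop :=
  I ⊆ F ∧ ((I.card : ℝ) ≤ l ∨ ∃ S ∈ I, ∃ T ∈ I, S ⊆ T ∧
    ∀ a ∈ S, ∀ b ∉ T, (I.card : ℝ) - (coord v a - coord v b) ≤ l)

/-- Moving the root changes a coordinate difference by at most the length of the added edge. -/
theorem BranchBound.extend {F I : Finset (Finset (Option (Fin n)))} {u v : MZ n} {l : ℝ}
    (h : BranchBound F u l I) : BranchBound F v (l + ‖u - v‖) I := by
  obtain ⟨hF, h | ⟨S, hS, T, hT, hST, h⟩⟩ := h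
  · exact ⟨hF, Or.inl (h.trans (le_add_of_nonneg_right (norm_nonneg _)))⟩
  · refine ⟨hF, Or.inr ⟨S, hS, T, hT, hST, fun a ha b hb => ?_⟩⟩
    have h1 := h a ha b hb
    have h2 := coord_sub_coord_le_norm (u - v) a b
    simp only [coord_sub] at h2
    linarith

/-- When both branches have a deficit, the two bounds are added at a common index so that the
differences telescope. If `S ⊆ T'` or `S' ⊆ T`, one difference survives; the two inclusions never
hold together, so an index in `S' \ T` or `S \ T'` is available. If neither holds, the differences
cancel. -/
theorem BranchBound.merge {k : ℕ} {I J : Finset (Finset (Option (Fin n)))} {v : MZ n} {l l' : ℝ}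
    (hIJ : Disjoint I J) (h : BranchBound (twoLayers _ k) v l I)
    (h' : BranchBound (twoLayers _ k) v l' J) :
    BranchBound (twoLayers _ k) v (l + l') (I ∪ J) := by
  obtain ⟨hF, h⟩ := h
  obtain ⟨hF', h'⟩ := h'
  refine ⟨Finset.union_subset hF hF', ?_⟩
  rw [Finset.card_union_of_disjoint hIJ]
  push_cast
  rcases h with h | ⟨S, hS, T, hT, hST, h⟩ <;> rcases h' with h' | ⟨S', hS', T', hT', hST', h'⟩
  · exact Or.inl (add_le_add h h')
  · refine Or.inr ⟨S', Finset.mem_union_right _ hS', T', Finset.mem_union_right _ hT', hST',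
      fun a ha b hb => ?_⟩
    linarith [h' a ha b hb]
  · refine Or.inr ⟨S, Finset.mem_union_left _ hS, T, Finset.mem_union_left _ hT, hST,
      fun a ha b hb => ?_⟩
    linarith [h a ha b hb]
  · by_cases h1 : S ⊆ T'
    · have hd : ∀ X ∈ I, ∀ Y ∈ J, X ≠ Y := fun X hX Y hY hXY =>
        Finset.disjoint_left.1 hIJ hX (hXY ▸ hY)
      have h2 := not_subset_of_mem_twoLayers (hF hS) (hF hT) (hF' hS') (hF' hT') hST hST'
        (hd S hS S' hS') (hd S hS T' hT') (hd T hT S' hS') (hd T hT T' hT') h1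
      obtain ⟨c, hc, hcT⟩ := Finset.not_subset.1 h2
      refine Or.inr ⟨S, Finset.mem_union_left _ hS, T', Finset.mem_union_right _ hT', h1,
        fun a ha b hb => ?_⟩
      linarith [h a ha c hcT, h' c hc b hb]
    · obtain ⟨a, ha, haT'⟩ := Finset.not_subset.1 h1
      by_cases h2 : S' ⊆ T
      · refine Or.inr ⟨S', Finset.mem_union_right _ hS', T, Finset.mem_union_left _ hT, h2,
          fun c hc b hb => ?_⟩
        linarith [h a ha b hb, h' c hc a haT']
      · obtain ⟨b, hb, hbT⟩ := Finset.not_subset.1 h2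
        left
        linarith [h a ha b hbT, h' b hb a haT']

theorem card_le_graphLength {k : ℕ}
    (hne : ∀ S ∈ twoLayers (Option (Fin n)) k, (∃ a, a ∈ S) ∧ ∃ b, b ∉ S)
    {T : (⊤ : SimpleGraph (MZ n)).Subgraph} (hfin : T.verts.Finite) (hT : T.coe.Connected)
    (h0 : (0 : MZ n) ∈ T.verts)
    (hP : ∀ S ∈ twoLayers (Option (Fin n)) k, indicatorPoint S ∈ T.verts) :
    ((twoLayers (Option (Fin n)) k).card : ℝ) ≤ graphLength T := by
  classical
  set F := twoLayers (Option (Fin n)) k with hF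
  obtain ⟨par, rank, hpar⟩ := SimpleGraph.Subgraph.exists_parent hT h0
  have key := accumulate_at_root (Q := BranchBound F)
    (fun u v l l' I J hIJ h h' => h.merge hIJ h'.extend) par rank hfin.toFinset
    (hfin.mem_toFinset.2 h0)
    (fun v hv hv0 => by
      have := hpar v (hfin.mem_toFinset.1 hv) hv0
      exact ⟨hfin.mem_toFinset.2 (T.edge_vert (T.adj_symm this.1)), this.2⟩)
    (fun _ => 0) (fun v => F.filter fun S => indicatorPoint S = v)
    (fun u _ v _ huv => Finset.disjoint_filter.2 fun S _ h1 h2 => huv (h1.symm.trans h2))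
    (fun v _ => by
      refine ⟨Finset.filter_subset _ _, ?_⟩
      by_cases hv : ∃ S ∈ F, indicatorPoint S = v
      · obtain ⟨S, hS, rfl⟩ := hv
        obtain ⟨⟨a, ha⟩, b, hb⟩ := hne S hS
        have hsingle : (F.filter fun S' => indicatorPoint S' = indicatorPoint S) = {S} := by
          ext S'
          simp only [Finset.mem_filter, Finset.mem_singleton]
          refine ⟨fun h => (eq_of_indicatorPoint_eq ha hb h.2.symm).symm, ?_⟩
          rintro rfl
          exact ⟨hS, rfl⟩
        rw [hsingle]
        -- A single terminal starts with length 0: its coordinate differences from `S` to the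
        -- complement are exactly 1.
        refine Or.inr ⟨S, Finset.mem_singleton_self S, S, Finset.mem_singleton_self S,
          subset_rfl, fun a ha b hb => ?_⟩
        rw [coord_indicatorPoint_sub, if_pos ha, if_neg hb]
        simp
      · left
        rw [Finset.filter_false_of_mem fun S hS h => hv ⟨S, hS, h⟩]
        simp)
  have hunion : (hfin.toFinset.biUnion fun v => F.filter fun S => indicatorPoint S = v) = F := by
    ext S
    simp only [Finset.mem_biUnion, Finset.mem_filter]
    exact ⟨fun ⟨_, _, h, _⟩ => h, fun h => ⟨_, hfin.mem_toFinset.2 (hP S h), h, rfl⟩⟩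
  rw [hunion, Finset.sum_const_zero, zero_add] at key
  refine le_trans ?_ (sum_parent_le_graphLength hfin hpar)
  obtain ⟨-, h | ⟨S, hS, S', hS', -, h⟩⟩ := key
  · exact h
  · obtain ⟨⟨a, ha⟩, -⟩ := hne S hS
    obtain ⟨-, b, hb⟩ := hne S' hS'
    simpa using h a ha b hb

theorem choose_mem_givenPointDegrees (hn : 2 ≤ n) :
    (n + 2).choose ((n + 2) / 2) ∈ givenPointDegrees (MZ n) := by
  classical
  -- The layers `k` and `k + 1` of an (n+1)-element set together have `(n + 2).choose (k + 1)`
  -- members; `2 ≤ n` keeps the empty and the full set out.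
  obtain ⟨k, hk⟩ : ∃ k, (n + 2) / 2 = k + 1 := ⟨n / 2, by omega⟩
  set F := twoLayers (Option (Fin n)) k with hF
  have hne : ∀ S ∈ F, (∃ a, a ∈ S) ∧ ∃ b, b ∉ S := by
    intro S hS
    rw [hF, mem_twoLayers] at hS
    refine ⟨Finset.card_pos.1 (by omega), ?_⟩
    by_contra! h
    have h1 := Finset.card_univ (α := Option (Fin n))
    rw [← Finset.eq_univ_iff_forall.2 h, Fintype.card_option, Fintype.card_fin] at h1
    omega
  have hinj : Set.InjOn indicatorPoint (F : Set (Finset (Option (Fin n)))) := by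
    intro S hS T _ h
    obtain ⟨⟨a, ha⟩, b, hb⟩ := hne S hS
    exact eq_of_indicatorPoint_eq ha hb h
  have h0 : (0 : MZ n) ∉ F.image indicatorPoint := by
    intro h
    obtain ⟨S, hS, h⟩ := Finset.mem_image.1 h
    obtain ⟨⟨a, ha⟩, b, hb⟩ := hne S hS
    exact indicatorPoint_ne_zero ha hb h
  refine ⟨insert 0 (F.image indicatorPoint), starTree _ h0, 0, ⟨⟨?_, ?_, starTree_isTree _ h0⟩,
    fun T hT => ?_⟩, Finset.mem_insert_self _ _, ?_⟩
  · exact (Finset.finite_toSet _).insert 0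
  · rw [Finset.coe_insert]
    exact subset_rfl
  · refine (graphLength_starTree_le _ h0).trans ?_
    refine le_trans ?_ (card_le_graphLength hne hT.1 hT.2.2.connected
      (hT.2.1 (Finset.mem_insert_self _ _))
      fun S hS => hT.2.1 (Finset.mem_insert_of_mem (Finset.mem_image_of_mem _ hS)))
    rw [Finset.sum_image hinj]
    refine (Finset.sum_le_card_nsmul _ _ 1 fun S _ => norm_indicatorPoint_le S).trans_eq ?_
    simp [hF]
  · rw [neighborSet_starTree, Set.ncard_coe_finset, Finset.card_image_of_injOn hinj, hF,
      card_twoLayers, hk, Fintype.card_option, Fintype.card_fin]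

/-! ### The upper bound -/

/-- With equal sets, a Steiner point at distance at most `ε` from `p` brings both neighbours nearer
by `ε`: a gain of `2 * ε` for a cost of `ε`. -/
theorem argmax_injOn_neighborSet {N : Finset (MZ n)} {T : (⊤ : SimpleGraph (MZ n)).Subgraph}
    (hT : IsSteinerMinimalTree N T) {p : MZ n} (hp : p ∈ N) :
    Set.InjOn (fun q => argmax (q - p)) (T.neighborSet p) := by
  classical
  intro q₁ h₁ q₂ h₂ heq
  by_contra hne
  simp only at heq
  have hq : ∀ q ∈ T.neighborSet p, q - p ≠ 0 := fun q hq => sub_ne_zero.2 (T.adj_sub hq).ne'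
  obtain ⟨δ₁, hδ₁, H₁⟩ := exists_norm_sub_le (hq q₁ h₁)
  obtain ⟨δ₂, hδ₂, H₂⟩ := exists_norm_sub_le (hq q₂ h₂)
  set ε := min δ₁ δ₂
  have hε : 0 < ε := lt_min hδ₁ hδ₂
  have hw : ∀ a, 0 ≤ (if a ∈ argmax (q₁ - p) then (1 : ℝ) else 0) ∧
      (if a ∈ argmax (q₁ - p) then (1 : ℝ) else 0) ≤ 2 := fun a => by split_ifs <;> norm_num
  have hgap : ∀ a ∈ argmax (q₁ - p), ∀ b ∉ argmax (q₁ - p),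
      (if b ∈ argmax (q₁ - p) then (1 : ℝ) else 0) + 1 ≤ if a ∈ argmax (q₁ - p) then 1 else 0 :=
    fun a ha b hb => by rw [if_pos ha, if_neg hb]; norm_num
  have b₁ := H₁ ε hε (min_le_left _ _) _ hw hgap
  have b₂ := H₂ ε hε (min_le_right _ _) _ hw (heq ▸ hgap)
  set s : MZ n := ε • indicatorPoint (argmax (q₁ - p)) with hs
  have hsn : ‖s‖ ≤ ε := by
    rw [hs, norm_smul, Real.norm_of_nonneg hε.le]
    exact mul_le_of_le_one_right hε.le (norm_indicatorPoint_le _)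
  set D : Finset (Sym2 (MZ n)) := {s(p, p + s), s(p + s, q₁), s(p + s, q₂)} with hD
  have r₀ := reachable_fromEdgeSet_of_mem (D := D) (x := p) (y := p + s) (by simp [hD])
  have r₁ := r₀.trans (reachable_fromEdgeSet_of_mem (y := q₁) (by simp [hD]))
  have r₂ := r₀.trans (reachable_fromEdgeSet_of_mem (y := q₂) (by simp [hD]))
  have key := hT.sum_le_sum hp (R := {s(p, q₁), s(p, q₂)}) (D := D)
    (by
      intro e he
      simp only [Finset.coe_insert, Finset.coe_singleton, Set.mem_insert_iff,
        Set.mem_singleton_iff] at he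
      rcases he with rfl | rfl
      exacts [h₁, h₂])
    (by
      intro x y hxy
      simp only [Finset.mem_insert, Finset.mem_singleton, Sym2.eq_iff] at hxy
      rcases hxy with (⟨rfl, rfl⟩ | ⟨rfl, rfl⟩) | (⟨rfl, rfl⟩ | ⟨rfl, rfl⟩)
      exacts [r₁, r₁.symm, r₂, r₂.symm])
  rw [Finset.sum_pair (fun h => hne (Sym2.congr_right.1 h)), edgeLength_mk, edgeLength_mk,
    norm_sub_rev p, norm_sub_rev p] at key
  have hDle : ∑ e ∈ D, edgeLength e ≤ ‖p - (p + s)‖ + (‖p + s - q₁‖ + ‖p + s - q₂‖) :=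
    (sum_edgeLength_insert_le _ _).trans (add_le_add le_rfl
      ((sum_edgeLength_insert_le _ _).trans (add_le_add le_rfl (Finset.sum_singleton _ _).le)))
  rw [sub_add_cancel_left, norm_neg, norm_sub_rev _ q₁, norm_sub_rev _ q₂, ← sub_sub,
    ← sub_sub] at hDle
  have b₁' : ‖q₁ - p - s‖ ≤ ‖q₁ - p‖ - ε := b₁
  have b₂' : ‖q₂ - p - s‖ ≤ ‖q₂ - p‖ - ε := b₂
  linarith

/-- The edges to the three neighbours are replaced by a path p, p+v, p+w, with `q₂` attached to p+v
and `q₁`, `q₃` to p+w. The path costs at most `2 * ε` while each neighbour gains `ε`. -/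
theorem not_argmax_three_chain {N : Finset (MZ n)} {T : (⊤ : SimpleGraph (MZ n)).Subgraph}
    (hT : IsSteinerMinimalTree N T) {p : MZ n} (hp : p ∈ N) {q₁ q₂ q₃ : MZ n}
    (h₁ : T.Adj p q₁) (h₂ : T.Adj p q₂) (h₃ : T.Adj p q₃)
    (h₁₂ : argmax (q₁ - p) ⊂ argmax (q₂ - p)) : ¬ argmax (q₂ - p) ⊂ argmax (q₃ - p) := by
  classical
  intro h₂₃
  have hne₁₂ : q₁ ≠ q₂ := fun h => h₁₂.ne (by rw [h])
  have hne₂₃ : q₂ ≠ q₃ := fun h => h₂₃.ne (by rw [h])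
  have hne₁₃ : q₁ ≠ q₃ := fun h => (h₁₂.trans h₂₃).ne (by rw [h])
  obtain ⟨δ₁, hδ₁, H₁⟩ := exists_norm_sub_le (sub_ne_zero.2 (T.adj_sub h₁).ne')
  obtain ⟨δ₂, hδ₂, H₂⟩ := exists_norm_sub_le (sub_ne_zero.2 (T.adj_sub h₂).ne')
  obtain ⟨δ₃, hδ₃, H₃⟩ := exists_norm_sub_le (sub_ne_zero.2 (T.adj_sub h₃).ne')
  set A₁ := argmax (q₁ - p)
  set A₂ := argmax (q₂ - p)
  set A₃ := argmax (q₃ - p)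
  have i₁₂ : ∀ a, a ∈ A₁ → a ∈ A₂ := fun a ha => h₁₂.1 ha
  have i₂₃ : ∀ a, a ∈ A₂ → a ∈ A₃ := fun a ha => h₂₃.1 ha
  obtain ⟨ε, hε, hε₁, hε₂, hε₃⟩ : ∃ ε > 0, ε ≤ δ₁ ∧ ε ≤ δ₂ ∧ ε ≤ δ₃ :=
    ⟨min δ₁ (min δ₂ δ₃), lt_min hδ₁ (lt_min hδ₂ hδ₃), min_le_left _ _,
      (min_le_right _ _).trans (min_le_left _ _), (min_le_right _ _).trans (min_le_right _ _)⟩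
  -- This sum drops by at least 1 on leaving `A₁` and on leaving `A₃`, so one point serves both `q₁`
  -- and `q₃`. Along a chain it exceeds the indicator of `A₂` by 0 or 1 only, hence `‖v - w‖ ≤ ε`.
  let f : Option (Fin n) → ℝ := fun a => (if a ∈ A₁ then 1 else 0) + if a ∈ A₃ then 1 else 0
  set v : MZ n := ε • indicatorPoint A₂ with hv
  set w : MZ n := ε • ofCoord f with hw
  have hf : ∀ a, 0 ≤ f a ∧ f a ≤ 2 := fun a => by
    simp only [f]
    split_ifs <;> norm_num
  have b₁ : ‖q₁ - p - w‖ ≤ ‖q₁ - p‖ - ε := H₁ ε hε hε₁ f hf fun a ha b hb => by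
    simp only [f]
    rw [if_pos ha, if_pos (i₂₃ a (i₁₂ a ha)), if_neg hb]
    split_ifs <;> norm_num
  have b₂ : ‖q₂ - p - v‖ ≤ ‖q₂ - p‖ - ε :=
    H₂ ε hε hε₂ (fun a => if a ∈ A₂ then 1 else 0) (fun a => by split_ifs <;> norm_num)
      fun a ha b hb => by
        rw [if_pos ha, if_neg hb]
        norm_num
  have b₃ : ‖q₃ - p - w‖ ≤ ‖q₃ - p‖ - ε := H₃ ε hε hε₃ f hf fun a ha b hb => by
    simp only [f]
    rw [if_pos ha, if_neg hb, if_neg fun h => hb (i₂₃ b (i₁₂ b h))]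
    split_ifs <;> norm_num
  have bv : ‖v‖ ≤ ε := by
    rw [hv, norm_smul, Real.norm_of_nonneg hε.le]
    exact mul_le_of_le_one_right hε.le (norm_indicatorPoint_le _)
  have bvw : ‖v - w‖ ≤ ε := by
    rw [hv, hw, ← smul_sub, norm_smul, Real.norm_of_nonneg hε.le]
    refine mul_le_of_le_one_right hε.le (norm_le_of_coord_sub_le fun a b => ?_)
    have hg : ∀ c, -1 ≤ (if c ∈ A₂ then (1 : ℝ) else 0) - f c ∧
        (if c ∈ A₂ then (1 : ℝ) else 0) - f c ≤ 0 := by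
      intro c
      simp only [f]
      by_cases c₁ : c ∈ A₁
      · simp [c₁, i₁₂ c c₁, i₂₃ c (i₁₂ c c₁)]
      · by_cases c₂ : c ∈ A₂
        · simp [c₁, c₂, i₂₃ c c₂]
        · simp only [c₁, c₂, if_false]
          split_ifs <;> norm_num
    simp only [coord_sub, indicatorPoint, coord_ofCoord]
    linarith [hg a, hg b]
  set D : Finset (Sym2 (MZ n)) :=
    {s(p, p + v), s(p + v, p + w), s(p + v, q₂), s(p + w, q₁), s(p + w, q₃)} with hD
  have rv := reachable_fromEdgeSet_of_mem (D := D) (x := p) (y := p + v) (by simp [hD])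
  have rw' := rv.trans (reachable_fromEdgeSet_of_mem (y := p + w) (by simp [hD]))
  have r₁ := rw'.trans (reachable_fromEdgeSet_of_mem (y := q₁) (by simp [hD]))
  have r₂ := rv.trans (reachable_fromEdgeSet_of_mem (y := q₂) (by simp [hD]))
  have r₃ := rw'.trans (reachable_fromEdgeSet_of_mem (y := q₃) (by simp [hD]))
  have key := hT.sum_le_sum hp (R := {s(p, q₁), s(p, q₂), s(p, q₃)}) (D := D)
    (by
      intro e he
      simp only [Finset.coe_insert, Finset.coe_singleton, Set.mem_insert_iff,
        Set.mem_singleton_iff] at he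
      rcases he with rfl | rfl | rfl
      exacts [h₁, h₂, h₃])
    (by
      intro x y hxy
      simp only [Finset.mem_insert, Finset.mem_singleton, Sym2.eq_iff] at hxy
      rcases hxy with (⟨rfl, rfl⟩ | ⟨rfl, rfl⟩) | (⟨rfl, rfl⟩ | ⟨rfl, rfl⟩) |
        (⟨rfl, rfl⟩ | ⟨rfl, rfl⟩)
      exacts [r₁, r₁.symm, r₂, r₂.symm, r₃, r₃.symm])
  rw [Finset.sum_insert (by simp [hne₁₂, hne₁₃, (T.adj_sub h₂).ne, (T.adj_sub h₃).ne]),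
    Finset.sum_pair (fun h => hne₂₃ (Sym2.congr_right.1 h)), edgeLength_mk, edgeLength_mk,
    edgeLength_mk, norm_sub_rev p, norm_sub_rev p, norm_sub_rev p] at key
  have hDle : ∑ e ∈ D, edgeLength e ≤ ‖p - (p + v)‖ + (‖p + v - (p + w)‖ + (‖p + v - q₂‖ +
      (‖p + w - q₁‖ + ‖p + w - q₃‖))) :=
    (sum_edgeLength_insert_le _ _).trans (add_le_add le_rfl
      ((sum_edgeLength_insert_le _ _).trans (add_le_add le_rfl
        ((sum_edgeLength_insert_le _ _).trans (add_le_add le_rfl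
          ((sum_edgeLength_insert_le _ _).trans (add_le_add le_rfl
            (Finset.sum_singleton _ _).le)))))))
  rw [sub_add_cancel_left, norm_neg, add_sub_add_left_eq_sub, norm_sub_rev _ q₁, norm_sub_rev _ q₂,
    norm_sub_rev _ q₃, ← sub_sub, ← sub_sub, ← sub_sub] at hDle
  linarith

theorem choose_mem_upperBounds :
    (n + 2).choose ((n + 2) / 2) ∈ upperBounds (givenPointDegrees (MZ n)) := by
  classical
  rintro _ ⟨N, T, p, hT, hp, rfl⟩
  have hfin : (T.neighborSet p).Finite :=
    hT.1.1.subset fun q hq => T.edge_vert (T.adj_symm hq)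
  have hcard := card_le_choose_of_no_three_chain (hfin.toFinset.image fun q => argmax (q - p)) (by
    simp only [Finset.mem_image, Set.Finite.mem_toFinset]
    rintro _ ⟨q₁, h₁, rfl⟩ _ ⟨q₂, h₂, rfl⟩ _ ⟨q₃, h₃, rfl⟩ h
    exact not_argmax_three_chain hT hp h₁ h₂ h₃ h)
  rw [Finset.card_image_of_injOn (by simpa using argmax_injOn_neighborSet hT hp),
    ← Set.ncard_eq_toFinset_card _ hfin] at hcard
  rwa [Fintype.card_option, Fintype.card_fin] at hcard

end MZ

theorem theorem1 (n : ℕ) (hn : 3 ≤ n) :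
    IsGreatest (givenPointDegrees (MZ n)) ((n + 2).choose ((n + 2) / 2)) ∧
      (n + 2).choose ((n + 2) / 2) < 2 ^ (n + 1) - 2 :=
  ⟨⟨MZ.choose_mem_givenPointDegrees (by omega), MZ.choose_mem_upperBounds⟩,
    choose_half_lt_two_pow hn⟩
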